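/- Let $X=(T,W)$ with treatments $T=(X_1,\dots,X_J)$ and controls $W\in\mathbb R^{k}$, let $X\in\mathcal X$ almost surely, $\mathcal X\subseteq\mathbb R^{J+k}$, and let $$H=h(X,U)\in\mathcal H,\qquad R=r(H,V)\in\mathcal R ,$$ where $U,V$ are random elements of standard Borel spaces $\mathcal U,\mathcal V$, $\mathcal H\subseteq\mathbb R$ is an interval (bounded or not), the response space $\mathcal R\subset\mathbb R$ is a bounded convex set (for instance $[0,\bar R]$), and $h,r$ are measurable. Fix versions $F_{V|W}$ and $F_{U|W,V}$ of the conditional distributions of $V$ given $W$ and of $U$ given $(W,V)$. Assume: * HONEST: for every $v$, $r(\cdot,v)$ is weakly increasing and left-continuous on $\mathcal H$. Reporting is continuous: $r(\cdot,v)$ is absolutely continuous on every compact interval in $\mathcal H$ (as it is if it is continuous and differentiable except at isolated points). Write $r'(\cdot,v)$ for its derivative. * EXOG: $T$ is independent of $V$ conditionally on $W$, and $T$ is independent of $U$ conditionally on $(W,V)$. Then, with $x=(t,w)$, $F_{V|W=w}$ is a version of the conditional distribution of $V$ given $X=x$, $F_{U|W=w,V=v}$ is a version of the conditional distribution of $U$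 given $X=x,V=v$, and the corresponding version $\mathbb E[R|X=x]=\int dF_{V|W}(v|w)\int dF_{U|W,V}(u|w,v)\,r(h(x,u),v)$ of the conditional mean satisfies $\mathbb E[R|X]=\mathbb E[R|X=x]|_{x=X}$ almost surely. Conditional laws given $X=x,V=v$ below are those of functions of $U$ under $F_{U|W=w,V=v}$; let $f(\cdot|x,v)$ be a density of $H$ given $X=x,V=v$ (assumed to exist for all $x\in\mathcal X$, $v\in\mathcal V$). Say that $j\in\{1,\dots,J\}$ satisfies REG if, with $\mathcal X_j$ the set of all $x$ such that all points obtained from $x$ by a sufficiently small change of $x_j$ lie in $\mathcal X$: * $X_j$ is continuously distributed, and so is $H$ conditionally on $X=x$, $V=v$, for all $x\in\mathcal X$, $v\in\mathcal V$; * for some $M<\infty$ the conditional quantile function of $H$ given $X,V$ has a partial derivative $\partial_{x_j}Q_{H|XV}(\alpha|x,v)\le M$ for all $\alpha\in(0,1)$, $x\in\mathcal X_j$, $v\in\mathcal V$; * $h(\cdot,u)$ has a partial derivative $\partial_{x_j}h(x,u)$ for all $x\in\mathcal X_j$, $u\in\mathcal U$, and there are a $\sigma$-finite measure $\nu$ on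 $\mathbb R$ (for instance Lebesgue measure) and a function $c$ with $\int c(h')|h'|\,d\nu(h')<\infty$ such that, for all $x\in\mathcal X_j$, $v\in\mathcal V$, the pair $(H,\partial_{x_j}h(x,U))$ has, given $X=x,V=v$, a density $f_{H,\partial_{x_j}h|XV}(h,h'|x,v)\le c(h')$ with respect to $dh\,d\nu(h')$. Then for every $j$ satisfying REG and every $x=(t,w)\in\mathcal X_j$ with $$\lim_{h\to\pm\infty}f(h|x,v)\,\mathbb E\left[\partial_{x_j}h(x,U)\mid H=h,X=x,V=v\right]=0\quad\text{for all }v\in\mathcal V,$$ the partial derivative of $\mathbb E[R|X=x]$ in $x_j$ exists, the integrals below converge absolutely, and $$\partial_{x_j}\mathbb E[R|X=x]=\int dF_{V|W}(v|w)\int_{\mathcal H}dh\; r'(h,v)\,f(h|x,v)\,\mathbb E\left[\partial_{x_j}h(x,U)\mid H=h,X=x,V=v\right].$$ That is, $\nabla_x\mathbb E[R|X=x]=\int dF_{V|W}(v|w)\int dh\,r'(h,v)f(h|x,v)\,\mathbb E[\nabla_xh(x,U)\mid H=h,X=x,V=v]$, where $\nabla_x$ is the vector of the partial derivatives in those of $x_1,\dots,x_J$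 that satisfy REG. -/

import Mathlib

open MeasureTheory ProbabilityTheory Filter Topology

/-- Values `x = (t, w)` of the regressors: `t` lists the `J` treatment components `x₁, …, x_J`
and `w` the `k` control variables. -/
abbrev Regressors (J k : ℕ) : Type := (Fin J → ℝ) × (Fin k → ℝ)

/-- The regressor value obtained from `x` by giving treatment component `j` the value `s`. -/
def moveTo {J k : ℕ} (j : Fin J) (x : Regressors J k) (s : ℝ) : Regressors J k :=
  (Function.update x.1 j s, x.2)

/-- The model of subjective reports: `X = (T, W)` are the regressors, `U` the heterogeneity in
the structural function `h`, `V` the heterogeneity in the reporting function `r`; latent outcomes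
are `H = h (X, U)` and reports are `R = r (H, V)`. Reports lie in a bounded convex response
space, latent outcomes in an interval. -/
structure ReportModel (J k : ℕ) (Ω 𝒰 𝒱 : Type*) [MeasurableSpace Ω] [MeasurableSpace 𝒰]
    [MeasurableSpace 𝒱] where
  /-- the underlying probability measure -/
  P : Measure Ω
  isProb : IsProbabilityMeasure P
  /-- the treatment variables -/
  T : Ω → Fin J → ℝ
  /-- the control variables -/
  W : Ω → Fin k → ℝ
  U : Ω → 𝒰
  V : Ω → 𝒱
  measurable_T : Measurable T
  measurable_W : Measurable W
  measurable_U : Measurable U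
  measurable_V : Measurable V
  /-- the set of possible regressor values -/
  𝒳 : Set (Regressors J k)
  measurableSet_𝒳 : MeasurableSet 𝒳
  X_mem : ∀ᵐ ω ∂P, (T ω, W ω) ∈ 𝒳
  /-- the set of possible values of the latent outcome, bounded or not -/
  𝓗 : Set ℝ
  ordConnected_𝓗 : 𝓗.OrdConnected
  /-- the response space, for instance `[0, Rbar]` -/
  𝓡 : Set ℝ
  convex_𝓡 : Convex ℝ 𝓡
  bounded_𝓡 : Bornology.IsBounded 𝓡
  /-- the structural function -/
  h : Regressors J k → 𝒰 → ℝ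
  measurable_h : Measurable (Function.uncurry h)
  h_mem : ∀ x ∈ 𝒳, ∀ u, h x u ∈ 𝓗
  /-- the reporting function -/
  r : ℝ → 𝒱 → ℝ
  measurable_r : Measurable (Function.uncurry r)
  r_mem : ∀ y ∈ 𝓗, ∀ v, r y v ∈ 𝓡

attribute [instance] ReportModel.isProb

/-- A choice of the conditional distributions `F_{V|W}` and `F_{U|W,V}`. -/
structure CondLaws {J k : ℕ} {Ω 𝒰 𝒱 : Type*} [MeasurableSpace Ω] [MeasurableSpace 𝒰]
    [MeasurableSpace 𝒱] (m : ReportModel J k Ω 𝒰 𝒱) where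
  /-- the conditional distribution of `V` given `W = w` -/
  FV : Kernel (Fin k → ℝ) 𝒱
  /-- the conditional distribution of `U` given `W = w`, `V = v` -/
  FU : Kernel ((Fin k → ℝ) × 𝒱) 𝒰
  isMarkov_FV : IsMarkovKernel FV
  isMarkov_FU : IsMarkovKernel FU
  hasCondDistrib_FV : HasCondDistrib m.V m.W FV m.P
  hasCondDistrib_FU : HasCondDistrib m.U (fun ω => (m.W ω, m.V ω)) FU m.P

attribute [instance] CondLaws.isMarkov_FV CondLaws.isMarkov_FU

namespace ReportModel

variable {J k : ℕ} {Ω 𝒰 𝒱 : Type*} [MeasurableSpace Ω] [MeasurableSpace 𝒰] [MeasurableSpace 𝒱]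

/-- The regressors `X = (T, W)`. -/
def X (m : ReportModel J k Ω 𝒰 𝒱) (ω : Ω) : Regressors J k := (m.T ω, m.W ω)

/-- The latent outcome `H = h (X, U)`. -/
def H (m : ReportModel J k Ω 𝒰 𝒱) (ω : Ω) : ℝ := m.h (m.X ω) (m.U ω)

/-- The report `R = r (H, V)`. -/
def R (m : ReportModel J k Ω 𝒰 𝒱) (ω : Ω) : ℝ := m.r (m.H ω) (m.V ω)

/-- Weak honesty: `r (·, v)` is weakly increasing and left-continuous on `𝓗`, for every `v`. -/
def Honest (m : ReportModel J k Ω 𝒰 𝒱) : Prop :=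
  ∀ v, MonotoneOn (fun y => m.r y v) m.𝓗 ∧
    ∀ y ∈ m.𝓗, ContinuousWithinAt (fun y => m.r y v) (m.𝓗 ∩ Set.Iic y) y

/-- Continuous reporting: each `r (·, v)` is absolutely continuous on compact intervals in `𝓗`. -/
def ContinuousReporting (m : ReportModel J k Ω 𝒰 𝒱) : Prop :=
  ∀ v, ∀ a ∈ m.𝓗, ∀ b ∈ m.𝓗, AbsolutelyContinuousOnInterval (fun y => m.r y v) a b

/-- Conditional exogeneity: `T ⫫ V | W` and `T ⫫ U | (W, V)`. -/
def Exog [StandardBorelSpace Ω] (m : ReportModel J k Ω 𝒰 𝒱) : Prop :=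
  CondIndepFun (MeasurableSpace.comap m.W inferInstance) m.measurable_W.comap_le m.T m.V m.P ∧
  CondIndepFun (MeasurableSpace.comap (fun ω => (m.W ω, m.V ω)) inferInstance)
    (m.measurable_W.prodMk m.measurable_V).comap_le m.T m.U m.P

/-- The regressor values around which component `j` can be varied in both directions within `𝒳`. -/
def interiorAlong (m : ReportModel J k Ω 𝒰 𝒱) (j : Fin J) : Set (Regressors J k) :=
  {x | ∀ᶠ s in 𝓝 (x.1 j), moveTo j x s ∈ m.𝒳}

/-- The slope `r'(y, v)` of the reporting function. -/
noncomputable def slope (m : ReportModel J k Ω 𝒰 𝒱) (y : ℝ) (v : 𝒱) : ℝ :=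
  deriv (fun z => m.r z v) y

/-- The partial derivative `∂h(x, u)/∂x_j`. -/
noncomputable def dh (m : ReportModel J k Ω 𝒰 𝒱) (j : Fin J) (x : Regressors J k) (u : 𝒰) : ℝ :=
  deriv (fun s => m.h (moveTo j x s) u) (x.1 j)

end ReportModel

namespace CondLaws

variable {J k : ℕ} {Ω 𝒰 𝒱 : Type*} [MeasurableSpace Ω] [MeasurableSpace 𝒰] [MeasurableSpace 𝒱]
  {m : ReportModel J k Ω 𝒰 𝒱}

/-- Under exogeneity, the conditional distribution of `V` given `X = (t, w)`: `F_{V|W=w}`. -/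
noncomputable def FVgivenX (F : CondLaws m) : Kernel (Regressors J k) 𝒱 :=
  F.FV.comap (fun x => x.2) measurable_snd

/-- Under exogeneity, the conditional distribution of `U` given `X = (t, w)`, `V = v`:
`F_{U|W=w,V=v}`. -/
noncomputable def FUgivenXV (F : CondLaws m) : Kernel (Regressors J k × 𝒱) 𝒰 :=
  F.FU.comap (fun p => (p.1.2, p.2)) ((measurable_snd.comp measurable_fst).prodMk measurable_snd)

instance (F : CondLaws m) : IsMarkovKernel F.FVgivenX := by
  unfold FVgivenX; infer_instance

instance (F : CondLaws m) : IsMarkovKernel F.FUgivenXV := by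
  unfold FUgivenXV; infer_instance

/-- The conditional mean `E[R | X = x]`, the mean of `r (h (x, U), V)` under the conditional
distribution of `(U, V)` given `X = x`. -/
noncomputable def meanR (F : CondLaws m) (x : Regressors J k) : ℝ :=
  ∫ v, (∫ u, m.r (m.h x u) v ∂F.FUgivenXV (x, v)) ∂F.FVgivenX x

/-- The conditional distribution of `H` given `X = x`, `V = v`. -/
noncomputable def lawH (F : CondLaws m) (x : Regressors J k) (v : 𝒱) : Measure ℝ :=
  (F.FUgivenXV (x, v)).map (m.h x)

/-- The conditional quantile `Q_{H|XV}(α | x, v)`. -/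
noncomputable def quantileH (F : CondLaws m) (α : ℝ) (x : Regressors J k) (v : 𝒱) : ℝ :=
  sInf {y | α ≤ cdf (F.lawH x v) y}

/-- The regularity conditions for component `j`. In the last one, `ν` is a reference measure for
the values of the effect `∂h(x, U)/∂x_j`: Lebesgue measure, or for instance a point mass if the
effect is the same constant for everybody. -/
structure Reg (F : CondLaws m) (j : Fin J) : Prop where
  /-- `X_j` is continuously distributed -/
  continuous_X : m.P.map (fun ω => m.T ω j) ≪ volume
  /-- `H` is continuously distributed conditional on `X` and `V` -/
  continuous_H : ∀ x ∈ m.𝒳, ∀ v, F.lawH x v ≪ volume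
  /-- the partial derivatives in `x_j` of the conditional quantiles of `H` exist and are bounded
  above by a constant -/
  quantile : ∃ M : ℝ, ∀ x ∈ m.interiorAlong j, ∀ v, ∀ α ∈ Set.Ioo (0 : ℝ) 1,
    DifferentiableAt ℝ (fun s => F.quantileH α (moveTo j x s) v) (x.1 j) ∧
    deriv (fun s => F.quantileH α (moveTo j x s) v) (x.1 j) ≤ M
  /-- `h` is differentiable in `x_j` -/
  differentiable_h : ∀ x ∈ m.interiorAlong j, ∀ u,
    DifferentiableAt ℝ (fun s => m.h (moveTo j x s) u) (x.1 j)
  /-- the conditional density of `(H, ∂h(x, U)/∂x_j)` at `(y, y')` given `X = x`, `V = v` exists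
  and is at most `c y'`, where `∫ c(y') |y'| dν(y') < ∞` -/
  density : ∃ (ν : Measure ℝ) (c : ℝ → ENNReal), SigmaFinite ν ∧ Measurable c ∧
    ∫⁻ y', c y' * ‖y'‖ₑ ∂ν < ⊤ ∧
    ∀ x ∈ m.interiorAlong j, ∀ v, ∃ g : ℝ × ℝ → ENNReal, Measurable g ∧
      (∀ p, g p ≤ c p.2) ∧
      (F.FUgivenXV (x, v)).map (fun u => (m.h x u, m.dh j x u))
        = (volume.prod ν).withDensity g

/-- `f` is a version of the conditional density `f(· | x, v)` of `H` given `X = x`, `V = v`. -/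
def IsDensityH (F : CondLaws m) (x : Regressors J k) (v : 𝒱) (f : ℝ → ℝ) : Prop :=
  Measurable f ∧ (∀ y, 0 ≤ f y) ∧ F.lawH x v = volume.withDensity (fun y => ENNReal.ofReal (f y))

/-- `e` is a version of `y ↦ E[∂h(x, U)/∂x_j | H = y, X = x, V = v]`, the mean of the regular
conditional distribution of the effect given `H = y` (under the law given `X = x`, `V = v`). -/
def IsMeanEffect (F : CondLaws m) (j : Fin J) (x : Regressors J k) (v : 𝒱) (e : ℝ → ℝ) : Prop :=
  Measurable e ∧ ∀ᵐ y ∂F.lawH x v,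
    e y = ∫ y', y' ∂condDistrib (m.dh j x) (m.h x) (F.FUgivenXV (x, v)) y

end CondLaws

/-! Fix `v`. By exogeneity the law of `U` does not move with `x_j`, so only the paths `s ↦ h (moveTo
j x s) u` have to be differentiated. Let `ρ` be `r'(·, v)` on `𝓗` and zero elsewhere. Monotonicity
and the bounded response space bound the L¹ norm of `ρ` by the spread of reports, and absolute
continuity makes `r (·, v)` a constant plus a primitive of `ρ`.

As `ρ` is merely integrable, the chain rule may fail on individual paths; it holds on average. The
joint density bound decouples position and speed at each time: E[ψ(position) η(speed)] ≤ ∫ψ · ∫η c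
dν (`DominatedFlow.lintegral_mul_le`). Hence both the increments of the mean and the candidate
derivative E[ρ(H) ∂h] are controlled by the L¹ norm of `ρ` (`abs_increment_le`,
`abs_integral_mul_deriv_le`), which reduces the claim to continuous compactly supported `g`, dense
in L¹ (`hasDerivAt_integral_primitive`). For such `g` the chain rule is pathwise, and the limit
passes under the mean because only high speeds obstruct a uniform bound, and these carry little mass
(`hasDerivAt_integral_of_continuous`).

Disintegrating E[ρ(H) ∂h] along H gives the integral against `f` and `e`
(`integral_mul_condDistrib`). The Lipschitz constant of the mean is the same for all `v`, so
dominated convergence permits integration over `v`. -/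

/-! ### Truncation and increments of paths -/

/-- Convergence of integrals of functions that are bounded up to a small part of their mass. -/
theorem tendsto_integral_of_lintegral_tsub_le {α ι : Type*} [MeasurableSpace α] {μ : Measure α}
    [IsFiniteMeasure μ] {l : Filter ι} [l.IsCountablyGenerated] {D : ι → α → ℝ} {D₀ : α → ℝ}
    (hD : ∀ᶠ i in l, Integrable (D i) μ) (hD₀ : Integrable D₀ μ)
    (hlim : ∀ᵐ u ∂μ, Tendsto (fun i => D i u) l (𝓝 (D₀ u)))
    (hsmall : ∀ ε : ℝ, 0 < ε → ∃ B : ℝ, 0 ≤ B ∧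
      (∀ᶠ i in l, ∫⁻ u, (‖D i u‖ₑ - ENNReal.ofReal B) ∂μ ≤ ENNReal.ofReal ε) ∧
      ∫⁻ u, (‖D₀ u‖ₑ - ENNReal.ofReal B) ∂μ ≤ ENNReal.ofReal ε) :
    Tendsto (fun i => ∫ u, D i u ∂μ) l (𝓝 (∫ u, D₀ u ∂μ)) := by
  -- Clipping `E` to `[-B, B]` changes it by exactly the excess of `|E|` over `B`, which is the
  -- truncated subtraction in the hypothesis.
  have trunc : ∀ {B ε : ℝ} {E : α → ℝ}, 0 ≤ B → 0 ≤ ε → Integrable E μ →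
      ∫⁻ u, (‖E u‖ₑ - ENNReal.ofReal B) ∂μ ≤ ENNReal.ofReal ε →
      |∫ u, E u ∂μ - ∫ u, max (-B) (min B (E u)) ∂μ| ≤ ε := by
    intro B ε E hB hε hE h
    have hm : Integrable (fun u => max (-B) (min B (E u))) μ :=
      (integrable_const _).sup ((integrable_const _).inf hE)
    rw [← integral_sub hE hm]
    have h1 : ‖∫ u, E u - max (-B) (min B (E u)) ∂μ‖ₑ ≤ ENNReal.ofReal ε := by
      refine (enorm_integral_le_lintegral_enorm _).trans ((lintegral_mono fun u => ?_).trans h)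
      rw [Real.enorm_eq_ofReal_abs, Real.enorm_eq_ofReal_abs, ← ENNReal.ofReal_sub _ hB]
      rcases le_total (E u) B with h1 | h1
      · rcases le_total (-B) (E u) with h2 | h2
        · simp [h1, h2]
        · refine ENNReal.ofReal_le_ofReal ?_
          rw [min_eq_right h1, max_eq_left h2, abs_of_nonpos (by linarith),
            abs_of_nonpos (by linarith)]
          linarith
      · refine ENNReal.ofReal_le_ofReal ?_
        rw [min_eq_left h1, max_eq_right (by linarith), abs_of_nonneg (by linarith),
          abs_of_nonneg (by linarith)]
    rwa [Real.enorm_eq_ofReal_abs, ENNReal.ofReal_le_ofReal_iff hε] at h1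
  rw [Metric.tendsto_nhds]
  intro ε hε
  obtain ⟨B, hB, h1, h2⟩ := hsmall (ε / 4) (by positivity)
  have h3 : Tendsto (fun i => ∫ u, max (-B) (min B (D i u)) ∂μ) l
      (𝓝 (∫ u, max (-B) (min B (D₀ u)) ∂μ)) := by
    refine tendsto_integral_filter_of_dominated_convergence (fun _ => B) ?_ ?_
      (integrable_const _) ?_
    · filter_upwards [hD] with i hi
      exact (aestronglyMeasurable_const).sup ((aestronglyMeasurable_const).inf hi.1)
    · refine Eventually.of_forall fun i => Eventually.of_forall fun u => ?_
      rw [Real.norm_eq_abs, abs_le]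
      exact ⟨le_max_left _ _, max_le (by linarith) (min_le_left _ _)⟩
    · filter_upwards [hlim] with u hu
      exact tendsto_const_nhds.max (tendsto_const_nhds.min hu)
  filter_upwards [hD, h1, Metric.tendsto_nhds.1 h3 (ε / 4) (by positivity)] with i hi hi1 hi3
  have a1 := abs_le.1 (trunc hB (by positivity) hi hi1)
  have a2 := abs_le.1 (trunc hB (by positivity) hD₀ h2)
  rw [Real.dist_eq] at hi3 ⊢
  have a3 := abs_lt.1 hi3
  rw [abs_lt]
  constructor <;> linarith [a1.1, a1.2, a2.1, a2.2, a3.1, a3.2]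

/-- The increment of a differentiable function is at most the integral of its speed, be it finite
or not. -/
theorem enorm_sub_le_lintegral_of_hasDerivAt {f f' : ℝ → ℝ} {a b : ℝ}
    (hf : ∀ s ∈ Set.uIcc a b, HasDerivAt f (f' s) s) :
    ‖f b - f a‖ₑ ≤ ∫⁻ s in Set.uIoc a b, ‖f' s‖ₑ := by
  by_cases hfin : ∫⁻ s in Set.uIoc a b, ‖f' s‖ₑ = ⊤
  · rw [hfin]; exact le_top
  have hmeas : AEStronglyMeasurable f' (volume.restrict (Set.uIoc a b)) := by
    refine (measurable_deriv f).aestronglyMeasurable.congr ?_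
    filter_upwards [ae_restrict_mem measurableSet_uIoc] with s hs
    exact (hf s (Set.uIoc_subset_uIcc hs)).deriv
  have hint : IntervalIntegrable f' volume a b := by
    rw [intervalIntegrable_iff]
    exact ⟨hmeas, lt_top_iff_ne_top.2 hfin⟩
  rw [← intervalIntegral.integral_eq_sub_of_hasDerivAt hf hint,
    ← ofReal_norm, intervalIntegral.norm_intervalIntegral_eq, ofReal_norm]
  exact enorm_integral_le_lintegral_enorm _

/-! ### Flows with dominated joint law of position and speed -/

/-- A family `φ s` of differentiable paths whose position and speed have, at any time `s ∈ I`, a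
joint distribution dominated by `volume.prod κ`. -/
structure DominatedFlow {α : Type*} [MeasurableSpace α] (μ : Measure α) (φ φ' : ℝ → α → ℝ)
    (κ : Measure ℝ) (I : Set ℝ) : Prop where
  isOpen : IsOpen I
  ordConnected : I.OrdConnected
  measurable : Measurable (Function.uncurry φ)
  hasDerivAt : ∀ s ∈ I, ∀ u, HasDerivAt (fun t => φ t u) (φ' s u) s
  map_le : ∀ s ∈ I, μ.map (fun u => (φ s u, φ' s u)) ≤ volume.prod κ
  lintegral_ne_top : ∫⁻ y, ‖y‖ₑ ∂κ ≠ ⊤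

namespace DominatedFlow

variable {α : Type*} [MeasurableSpace α] {μ : Measure α} {φ φ' : ℝ → α → ℝ}
  {κ : Measure ℝ} {I : Set ℝ}

theorem measurable_apply (h : DominatedFlow μ φ φ' κ I) (s : ℝ) : Measurable (φ s) :=
  h.measurable.comp (measurable_const.prodMk measurable_id)

/-- The speed is a limit of difference quotients with steps `1 / (n + 1)`; the indicator removes
times at which no derivative is known. Measurability jointly in time and `u` is what Tonelli needs
below. -/
theorem measurable_indicator_deriv (h : DominatedFlow μ φ φ' κ I) :
    Measurable (fun p : ℝ × α => I.indicator (fun s => φ' s p.2) p.1) := by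
  refine measurable_of_tendsto_metrizable (f := fun (n : ℕ) (p : ℝ × α) =>
    I.indicator (fun s => ((n : ℝ) + 1) * (φ (s + 1 / ((n : ℝ) + 1)) p.2 - φ s p.2)) p.1) ?_ ?_
  · intro n
    have h1 : Measurable fun p : ℝ × α =>
        ((n : ℝ) + 1) * (φ (p.1 + 1 / ((n : ℝ) + 1)) p.2 - φ p.1 p.2) := by
      refine measurable_const.mul (Measurable.sub ?_ h.measurable)
      exact h.measurable.comp ((measurable_fst.add_const _).prodMk measurable_snd)
    exact h1.indicator (measurable_fst h.isOpen.measurableSet)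
  · rw [tendsto_pi_nhds]
    rintro ⟨s, u⟩
    by_cases hs : s ∈ I
    · simp only [Set.indicator_of_mem hs]
      have h1 := (hasDerivAt_iff_tendsto_slope_zero.1 (h.hasDerivAt s hs u)).comp
        (tendsto_nhdsWithin_iff.2 ⟨tendsto_one_div_add_atTop_nhds_zero_nat,
          Eventually.of_forall fun n => (Nat.one_div_pos_of_nat (α := ℝ)).ne'⟩)
      refine h1.congr fun n => ?_
      simp
    · simp [Set.indicator_of_notMem hs]

theorem measurable_deriv (h : DominatedFlow μ φ φ' κ I) {s : ℝ} (hs : s ∈ I) :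
    Measurable (φ' s) := by
  have := h.measurable_indicator_deriv.comp (measurable_const (a := s) |>.prodMk measurable_id)
  simpa [Function.comp_def, Set.indicator_of_mem hs] using this

/-- Under the dominating product measure the integral of a product factorises. Every L¹ estimate on
the flow comes from this. -/
theorem lintegral_mul_le [SFinite κ] (h : DominatedFlow μ φ φ' κ I) {s : ℝ} (hs : s ∈ I)
    {ψ η : ℝ → ENNReal} (hψ : Measurable ψ) (hη : Measurable η) :
    ∫⁻ u, ψ (φ s u) * η (φ' s u) ∂μ ≤ (∫⁻ y, ψ y) * ∫⁻ y, η y ∂κ := by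
  have h1 : Measurable fun p : ℝ × ℝ => ψ p.1 * η p.2 :=
    (hψ.comp measurable_fst).mul (hη.comp measurable_snd)
  rw [← lintegral_prod_mul hψ.aemeasurable hη.aemeasurable,
    ← lintegral_map h1 ((h.measurable_apply s).prodMk (h.measurable_deriv hs))]
  exact lintegral_mono' (h.map_le s hs) le_rfl

/-- Increments of `G ∘ φ` are of the order of time, up to the contribution of high speeds. -/
theorem lintegral_increment_tsub_le [SFinite κ] [IsFiniteMeasure μ] (h : DominatedFlow μ φ φ' κ I)
    {g G : ℝ → ℝ} (hg : Measurable g) {A K : ℝ} (hA : ∀ y, |g y| ≤ A)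
    (hG : ∀ y, HasDerivAt G (g y) y) {a b : ℝ} (ha : a ∈ I) (hb : b ∈ I) :
    ∫⁻ u, (‖G (φ b u) - G (φ a u)‖ₑ - ENNReal.ofReal (A * K) * ‖b - a‖ₑ) ∂μ ≤
      ‖b - a‖ₑ * ((∫⁻ y, ‖g y‖ₑ) * ∫⁻ y in {y | K < |y|}, ‖y‖ₑ ∂κ) := by
  have hA0 : 0 ≤ A := (abs_nonneg _).trans (hA 0)
  set η : ℝ → ENNReal := {y : ℝ | K < |y|}.indicator (fun y => ‖y‖ₑ) with hη
  have hset : MeasurableSet {y : ℝ | K < |y|} := measurableSet_lt measurable_const measurable_abs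
  have hηm : Measurable η := measurable_enorm.indicator hset
  have hsub : Set.uIcc a b ⊆ I := h.ordConnected.uIcc_subset ha hb
  have hvol : volume (Set.uIoc a b) = ‖b - a‖ₑ := by
    rw [Set.uIoc, Real.volume_Ioc, max_sub_min_eq_abs, Real.enorm_eq_ofReal_abs]
  set Z : ℝ → α → ENNReal := fun s u => ‖g (φ s u)‖ₑ *
    η (I.indicator (fun s => φ' s u) s) with hZ
  have hZm : Measurable (Function.uncurry Z) :=
    (hg.comp h.measurable).enorm.mul (hηm.comp h.measurable_indicator_deriv)
  -- Along one path, speeds up to `K` contribute at most `A * K` per unit of time, which the left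
  -- side subtracts; `Z` keeps the faster ones. Tonelli then reduces the mean of the remainder to a
  -- bound at each single time.
  have key : ∀ u, ‖G (φ b u) - G (φ a u)‖ₑ - ENNReal.ofReal (A * K) * ‖b - a‖ₑ ≤
      ∫⁻ s in Set.uIoc a b, Z s u := by
    intro u
    rw [tsub_le_iff_right, add_comm, ← hvol, ← setLIntegral_const,
      ← lintegral_add_left measurable_const]
    refine (enorm_sub_le_lintegral_of_hasDerivAt (f := fun s => G (φ s u))
      (f' := fun s => g (φ s u) * φ' s u)
      fun s hs => (hG _).comp s (h.hasDerivAt s (hsub hs) u)).trans ?_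
    refine setLIntegral_mono' measurableSet_uIoc fun s hs => ?_
    simp only [hZ, Set.indicator_of_mem (hsub (Set.uIoc_subset_uIcc hs)), enorm_mul]
    by_cases hy : K < |φ' s u|
    · rw [hη, Set.indicator_of_mem (show φ' s u ∈ {y : ℝ | K < |y|} from hy)]
      exact le_add_self
    · refine le_add_right ?_
      rw [← enorm_mul, Real.enorm_eq_ofReal_abs, abs_mul]
      exact ENNReal.ofReal_le_ofReal (mul_le_mul (hA _) (not_lt.1 hy) (abs_nonneg _) hA0)
  calc _ ≤ ∫⁻ u, (∫⁻ s in Set.uIoc a b, Z s u) ∂μ := lintegral_mono key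
    _ = ∫⁻ s in Set.uIoc a b, (∫⁻ u, Z s u ∂μ) :=
      (lintegral_lintegral_swap hZm.aemeasurable).symm
    _ ≤ ∫⁻ _ in Set.uIoc a b, ((∫⁻ y, ‖g y‖ₑ) * ∫⁻ y in {y | K < |y|}, ‖y‖ₑ ∂κ) := by
      refine setLIntegral_mono' measurableSet_uIoc fun s hs => ?_
      have hs' := hsub (Set.uIoc_subset_uIcc hs)
      simp only [hZ, Set.indicator_of_mem hs']
      rw [← lintegral_indicator hset]
      exact h.lintegral_mul_le hs' hg.enorm hηm
    _ = _ := by rw [setLIntegral_const, hvol, mul_comm]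

theorem tendsto_setLIntegral_high_speed (h : DominatedFlow μ φ φ' κ I) :
    Tendsto (fun K : ℕ => ∫⁻ y in {y | (K : ℝ) < |y|}, ‖y‖ₑ ∂κ) atTop (𝓝 0) := by
  have hset : ∀ K : ℝ, MeasurableSet {y : ℝ | K < |y|} :=
    fun K => measurableSet_lt measurable_const measurable_abs
  simp_rw [← lintegral_indicator (hset _)]
  rw [← lintegral_zero (μ := κ)]
  refine tendsto_lintegral_of_dominated_convergence (fun y => ‖y‖ₑ)
    (fun K => measurable_enorm.indicator (hset K))
    (fun K => Eventually.of_forall fun y => Set.indicator_le_self _ _ y) h.lintegral_ne_top ?_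
  refine Eventually.of_forall fun y => tendsto_const_nhds.congr' ?_
  filter_upwards [eventually_ge_atTop ⌈|y|⌉₊] with K hK
  rw [Set.indicator_of_notMem]
  simpa using (Nat.le_ceil _).trans (Nat.cast_le.2 hK)

theorem integrable_mul_deriv [SFinite κ] (h : DominatedFlow μ φ φ' κ I) {ρ : ℝ → ℝ}
    (hρm : Measurable ρ) (hρ : Integrable ρ) {s : ℝ} (hs : s ∈ I) :
    Integrable (fun u => ρ (φ s u) * φ' s u) μ := by
  refine ⟨((hρm.comp (h.measurable_apply s)).mul (h.measurable_deriv hs)).aestronglyMeasurable, ?_⟩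
  simp only [HasFiniteIntegral, enorm_mul]
  exact (h.lintegral_mul_le hs hρm.enorm measurable_enorm).trans_lt
    (ENNReal.mul_lt_top hρ.2 h.lintegral_ne_top.lt_top)

theorem abs_integral_mul_deriv_le [SFinite κ] (h : DominatedFlow μ φ φ' κ I) {ρ : ℝ → ℝ}
    (hρm : Measurable ρ) (hρ : Integrable ρ) {s : ℝ} (hs : s ∈ I) :
    |∫ u, ρ (φ s u) * φ' s u ∂μ| ≤ (∫⁻ y, ‖y‖ₑ ∂κ).toReal * ∫ y, ‖ρ y‖ := by
  have h1 := (enorm_integral_le_lintegral_enorm (fun u => ρ (φ s u) * φ' s u) (μ := μ))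
  simp only [enorm_mul] at h1
  have h2 := h1.trans (h.lintegral_mul_le hs hρm.enorm measurable_enorm)
  have h3 := ENNReal.toReal_mono (ENNReal.mul_ne_top hρ.2.ne h.lintegral_ne_top) h2
  rwa [toReal_enorm, Real.norm_eq_abs, ENNReal.toReal_mul, mul_comm,
    ← integral_norm_eq_lintegral_enorm hρ.1] at h3

/-- The mean of `G (φ s)` is differentiable if `G` is continuously differentiable with an
integrable bounded derivative. -/
theorem hasDerivAt_integral_of_continuous [SFinite κ] [IsFiniteMeasure μ]
    (h : DominatedFlow μ φ φ' κ I)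
    {g G : ℝ → ℝ} (hg : Measurable g) (hgi : Integrable g) {A : ℝ} (hA : ∀ y, |g y| ≤ A)
    (hG : ∀ y, HasDerivAt G (g y) y) (hGi : ∀ s, Integrable (fun u => G (φ s u)) μ)
    {s₀ : ℝ} (hs₀ : s₀ ∈ I) :
    HasDerivAt (fun s => ∫ u, G (φ s u) ∂μ) (∫ u, g (φ s₀ u) * φ' s₀ u ∂μ) s₀ := by
  have hA0 : 0 ≤ A := (abs_nonneg _).trans (hA 0)
  rw [hasDerivAt_iff_tendsto_slope]
  have hslope : ∀ s, slope (fun s => ∫ u, G (φ s u) ∂μ) s₀ s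
      = ∫ u, slope (fun s => G (φ s u)) s₀ s ∂μ := by
    intro s
    simp only [slope_def_module, smul_eq_mul]
    rw [integral_const_mul, integral_sub (hGi s) (hGi s₀)]
  simp only [funext hslope]
  have hev : ∀ᶠ s in 𝓝[≠] s₀, s ∈ I ∧ s ≠ s₀ :=
    (eventually_nhdsWithin_of_eventually_nhds (h.isOpen.mem_nhds hs₀)).and
      eventually_mem_nhdsWithin
  -- The law of the speed is controlled at each time separately, which gives no common dominating
  -- function for the difference quotients; the criterion by small excess mass takes its place.
  refine tendsto_integral_of_lintegral_tsub_le ?_ (h.integrable_mul_deriv hg hgi hs₀) ?_ ?_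
  · refine Eventually.of_forall fun s => ?_
    simp only [slope_def_module, smul_eq_mul]
    exact ((hGi s).sub (hGi s₀)).const_mul _
  · refine Eventually.of_forall fun u => ?_
    exact hasDerivAt_iff_tendsto_slope.1 ((hG _).comp s₀ (h.hasDerivAt s₀ hs₀ u))
  · intro ε hε
    have hlim : Tendsto (fun K : ℕ => (∫⁻ y, ‖g y‖ₑ) * ∫⁻ y in {y | (K : ℝ) < |y|}, ‖y‖ₑ ∂κ)
        atTop (𝓝 0) := by
      have := ENNReal.Tendsto.const_mul h.tendsto_setLIntegral_high_speed
        (Or.inr hgi.2.ne) (a := ∫⁻ y, ‖g y‖ₑ)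
      rwa [mul_zero] at this
    obtain ⟨K, hK⟩ := (hlim.eventually_le_const (ENNReal.ofReal_pos.2 hε)).exists
    -- Where the speed is at most `K`, the derivative of `G` along the path is at most `A * K`; `K`
    -- was chosen so that higher speeds contribute at most `ε`.
    refine ⟨A * K, by positivity, ?_, ?_⟩
    · filter_upwards [hev] with s hs
      have hne : ‖s - s₀‖ₑ ≠ 0 := by simpa [sub_eq_zero] using hs.2
      have h1 := h.lintegral_increment_tsub_le hg hA (K := K) hG hs₀ hs.1
      refine le_trans ?_ hK
      have h2 : ∀ u, ‖slope (fun s => G (φ s u)) s₀ s‖ₑ - ENNReal.ofReal (A * K)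
          = ‖s - s₀‖ₑ⁻¹ * (‖G (φ s u) - G (φ s₀ u)‖ₑ -
            ENNReal.ofReal (A * K) * ‖s - s₀‖ₑ) := by
        intro u
        rw [slope_def_module, smul_eq_mul, enorm_mul, enorm_inv (sub_ne_zero.2 hs.2),
          ENNReal.mul_sub (fun _ _ => ENNReal.inv_ne_top.2 hne)]
        congr 1
        rw [mul_comm (ENNReal.ofReal _), ← mul_assoc, ENNReal.inv_mul_cancel hne enorm_ne_top,
          one_mul]
      simp only [h2]
      rw [lintegral_const_mul' _ _ (ENNReal.inv_ne_top.2 hne)]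
      refine (mul_le_mul_right h1 _).trans ?_
      rw [← mul_assoc, ENNReal.inv_mul_cancel hne enorm_ne_top, one_mul]
    · refine le_trans ?_ hK
      have hset : MeasurableSet {y : ℝ | (K : ℝ) < |y|} :=
        measurableSet_lt measurable_const measurable_abs
      rw [← lintegral_indicator hset]
      refine le_trans (lintegral_mono fun u => ?_)
        (h.lintegral_mul_le hs₀ hg.enorm (measurable_enorm.indicator hset))
      by_cases hy : (K : ℝ) < |φ' s₀ u|
      · rw [Set.indicator_of_mem (show φ' s₀ u ∈ {y : ℝ | (K : ℝ) < |y|} from hy), enorm_mul]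
        exact tsub_le_self
      · rw [tsub_eq_zero_of_le]
        · exact zero_le
        rw [Real.enorm_eq_ofReal_abs, abs_mul]
        exact ENNReal.ofReal_le_ofReal
          (mul_le_mul (hA _) (not_lt.1 hy) (abs_nonneg _) hA0)

end DominatedFlow

/-! ### From continuous to integrable derivatives, by density in L¹ -/

theorem abs_intervalIntegral_le_integral_norm {ρ : ℝ → ℝ} (hρ : Integrable ρ) (a b : ℝ) :
    |∫ t in a..b, ρ t| ≤ ∫ t, ‖ρ t‖ := by
  rw [← Real.norm_eq_abs]
  refine intervalIntegral.norm_integral_le_integral_norm_uIoc.trans ?_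
  exact setIntegral_le_integral hρ.norm (Eventually.of_forall fun _ => norm_nonneg _)

namespace DominatedFlow

variable {α : Type*} [MeasurableSpace α] {μ : Measure α} {φ φ' : ℝ → α → ℝ}
  {κ : Measure ℝ} {I : Set ℝ}

theorem integrable_primitive [IsFiniteMeasure μ] (h : DominatedFlow μ φ φ' κ I) {ρ : ℝ → ℝ}
    (hρ : Integrable ρ) (s : ℝ) :
    Integrable (fun u => ∫ t in (0 : ℝ)..φ s u, ρ t) μ := by
  have hc : Continuous fun y => ∫ t in (0 : ℝ)..y, ρ t :=
    intervalIntegral.continuous_primitive (fun a b => hρ.intervalIntegrable) 0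
  exact Integrable.of_bound ((hc.measurable.comp (h.measurable_apply s)).aestronglyMeasurable)
    (∫ t, ‖ρ t‖) (Eventually.of_forall fun u => abs_intervalIntegral_le_integral_norm hρ _ _)

/-- Increments of the mean depend continuously on the derivative of the integrand in `L¹`. -/
theorem abs_increment_sub_increment_le [IsProbabilityMeasure μ] (h : DominatedFlow μ φ φ' κ I)
    {ρ g : ℝ → ℝ} (hρ : Integrable ρ) (hg : Integrable g) (a b : ℝ) :
    |(∫ u, (∫ t in (0 : ℝ)..φ b u, ρ t) ∂μ - ∫ u, (∫ t in (0 : ℝ)..φ a u, ρ t) ∂μ) -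
      (∫ u, (∫ t in (0 : ℝ)..φ b u, g t) ∂μ - ∫ u, (∫ t in (0 : ℝ)..φ a u, g t) ∂μ)| ≤
      ∫ t, ‖ρ t - g t‖ := by
  rw [← integral_sub (h.integrable_primitive hρ b) (h.integrable_primitive hρ a),
    ← integral_sub (h.integrable_primitive hg b) (h.integrable_primitive hg a),
    ← integral_sub (Integrable.sub' (h.integrable_primitive hρ b) (h.integrable_primitive hρ a))
      (Integrable.sub' (h.integrable_primitive hg b) (h.integrable_primitive hg a))]
  have h1 := norm_integral_le_of_norm_le_const (μ := μ) (C := ∫ t, ‖ρ t - g t‖)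
    (f := fun u => ((∫ t in (0 : ℝ)..φ b u, ρ t) - ∫ t in (0 : ℝ)..φ a u, ρ t) -
      ((∫ t in (0 : ℝ)..φ b u, g t) - ∫ t in (0 : ℝ)..φ a u, g t))
    (Eventually.of_forall fun u => by
      rw [intervalIntegral.integral_interval_sub_left hρ.intervalIntegrable hρ.intervalIntegrable,
        intervalIntegral.integral_interval_sub_left hg.intervalIntegrable hg.intervalIntegrable,
        ← intervalIntegral.integral_sub hρ.intervalIntegrable hg.intervalIntegrable]
      exact abs_intervalIntegral_le_integral_norm (hρ.sub hg) _ _)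
  simpa using h1

theorem abs_increment_le_of_continuous [SFinite κ] [IsProbabilityMeasure μ]
    (h : DominatedFlow μ φ φ' κ I) {g : ℝ → ℝ} (hgc : Continuous g) (hgs : HasCompactSupport g)
    (hgi : Integrable g) {a b : ℝ} (ha : a ∈ I) (hb : b ∈ I) :
    |∫ u, (∫ t in (0 : ℝ)..φ b u, g t) ∂μ - ∫ u, (∫ t in (0 : ℝ)..φ a u, g t) ∂μ| ≤
      |b - a| * ((∫⁻ y, ‖y‖ₑ ∂κ).toReal * ∫ y, ‖g y‖) := by
  obtain ⟨A, hA⟩ := hgs.exists_bound_of_continuous hgc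
  rw [← integral_sub (h.integrable_primitive hgi b) (h.integrable_primitive hgi a)]
  -- With `K = 0` nothing is subtracted, so the estimate bounds the whole increment, and the bound
  -- `A` on `g` disappears from it.
  have h1 := h.lintegral_increment_tsub_le (G := fun y => ∫ t in (0 : ℝ)..y, g t)
    hgc.measurable hA (K := 0) (fun y => intervalIntegral.integral_hasDerivAt_right
      hgi.intervalIntegrable hgc.stronglyMeasurable.stronglyMeasurableAtFilter
      hgc.continuousAt) ha hb
  simp only [mul_zero, ENNReal.ofReal_zero, zero_mul, tsub_zero] at h1
  have h2 := ((enorm_integral_le_lintegral_enorm _).trans h1).trans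
    (mul_le_mul_right (mul_le_mul_right (setLIntegral_le_lintegral _ _) _) _)
  have h3 := ENNReal.toReal_mono (ENNReal.mul_ne_top enorm_ne_top
    (ENNReal.mul_ne_top hgi.2.ne h.lintegral_ne_top)) h2
  rwa [toReal_enorm, Real.norm_eq_abs, ENNReal.toReal_mul, ENNReal.toReal_mul, toReal_enorm,
    Real.norm_eq_abs, ← integral_norm_eq_lintegral_enorm hgi.1,
    mul_comm (∫ a, ‖g a‖)] at h3

/-- For fixed `a` and `b` both sides are continuous in `ρ` for the L¹ norm, so the bound extends
from continuous compactly supported functions. -/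
theorem abs_increment_le [SFinite κ] [IsProbabilityMeasure μ]
    (h : DominatedFlow μ φ φ' κ I) {ρ : ℝ → ℝ} (hρ : Integrable ρ) {a b : ℝ}
    (ha : a ∈ I) (hb : b ∈ I) :
    |∫ u, (∫ t in (0 : ℝ)..φ b u, ρ t) ∂μ - ∫ u, (∫ t in (0 : ℝ)..φ a u, ρ t) ∂μ| ≤
      |b - a| * ((∫⁻ y, ‖y‖ₑ ∂κ).toReal * ∫ y, ‖ρ y‖) := by
  set C := (∫⁻ y, ‖y‖ₑ ∂κ).toReal
  have hC : 0 ≤ C := ENNReal.toReal_nonneg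
  refine le_of_forall_pos_le_add fun ε hε => ?_
  -- An L¹ error `δ` costs `δ` in the increment and `|b - a| * C * δ` in the bound; these add up to
  -- `ε`.
  have hδ : 0 < ε / (1 + |b - a| * C) := by positivity
  obtain ⟨g, hgs, hle, hgc, hgi⟩ := hρ.exists_hasCompactSupport_integral_sub_le hδ
  have h1 := h.abs_increment_sub_increment_le hρ hgi a b
  have h2 := h.abs_increment_le_of_continuous hgc hgs hgi ha hb
  have h3 : ∫ y, ‖g y‖ ≤ (∫ y, ‖ρ y‖) + ε / (1 + |b - a| * C) := by
    have : ∫ y, ‖g y‖ ≤ ∫ y, (‖ρ y‖ + ‖ρ y - g y‖) :=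
      integral_mono hgi.norm (hρ.norm.add (hρ.sub hgi).norm) fun y => by
        have := norm_sub_le (ρ y) (ρ y - g y)
        simpa using this
    rw [integral_add hρ.norm (Integrable.sub' hρ hgi).norm] at this
    linarith
  have h4 : |b - a| * (C * ∫ y, ‖g y‖) ≤
      |b - a| * (C * ((∫ y, ‖ρ y‖) + ε / (1 + |b - a| * C))) := by gcongr
  have h5 : |b - a| * (C * ((∫ y, ‖ρ y‖) + ε / (1 + |b - a| * C))) + ε / (1 + |b - a| * C)
      = |b - a| * (C * ∫ y, ‖ρ y‖) + ε := by
    field_simp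
    ring
  have h6 := abs_sub_abs_le_abs_sub
    (∫ u, (∫ t in (0 : ℝ)..φ b u, ρ t) ∂μ - ∫ u, (∫ t in (0 : ℝ)..φ a u, ρ t) ∂μ)
    (∫ u, (∫ t in (0 : ℝ)..φ b u, g t) ∂μ - ∫ u, (∫ t in (0 : ℝ)..φ a u, g t) ∂μ)
  linarith

/-- The mean of a primitive of an integrable function along the flow is differentiable. -/
theorem hasDerivAt_integral_primitive [SFinite κ] [IsProbabilityMeasure μ]
    (h : DominatedFlow μ φ φ' κ I) {ρ : ℝ → ℝ} (hρm : Measurable ρ) (hρ : Integrable ρ)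
    {s₀ : ℝ} (hs₀ : s₀ ∈ I) :
    HasDerivAt (fun s => ∫ u, (∫ t in (0 : ℝ)..φ s u, ρ t) ∂μ)
      (∫ u, ρ (φ s₀ u) * φ' s₀ u ∂μ) s₀ := by
  set C := (∫⁻ y, ‖y‖ₑ ∂κ).toReal with hCdef
  have hC : 0 ≤ C := ENNReal.toReal_nonneg
  have hlin : ∀ {g : ℝ → ℝ} (_ : Integrable g) (s : ℝ),
      ∫ u, (∫ t in (0 : ℝ)..φ s u, (ρ t - g t)) ∂μ =
      ∫ u, (∫ t in (0 : ℝ)..φ s u, ρ t) ∂μ - ∫ u, (∫ t in (0 : ℝ)..φ s u, g t) ∂μ := by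
    intro g hg s
    rw [← integral_sub (h.integrable_primitive hρ s) (h.integrable_primitive hg s)]
    simp only [intervalIntegral.integral_sub hρ.intervalIntegrable hg.intervalIntegrable]
  rw [hasDerivAt_iff_tendsto_slope, Metric.tendsto_nhds]
  intro ε hε
  have hδ : 0 < ε / (4 * (1 + C)) := by positivity
  obtain ⟨g, hgs, hle, hgc, hgi⟩ := hρ.exists_hasCompactSupport_integral_sub_le hδ
  obtain ⟨A, hA⟩ := hgs.exists_bound_of_continuous hgc
  have hgd := h.hasDerivAt_integral_of_continuous (G := fun y => ∫ t in (0 : ℝ)..y, g t)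
    hgc.measurable hgi hA (fun y => intervalIntegral.integral_hasDerivAt_right
      hgi.intervalIntegrable hgc.stronglyMeasurable.stronglyMeasurableAtFilter
      hgc.continuousAt) (h.integrable_primitive hgi) hs₀
  rw [hasDerivAt_iff_tendsto_slope, Metric.tendsto_nhds] at hgd
  have hCle : C * ∫ y, ‖ρ y - g y‖ ≤ ε / 4 := by
    calc C * ∫ y, ‖ρ y - g y‖ ≤ (1 + C) * (ε / (4 * (1 + C))) := by gcongr; linarith
      _ = ε / 4 := by field_simp
  have h2 := h.abs_integral_mul_deriv_le (hρm.sub hgc.measurable) (hρ.sub hgi) hs₀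
  simp only [Pi.sub_apply, sub_mul] at h2
  rw [integral_sub (h.integrable_mul_deriv hρm hρ hs₀)
    (h.integrable_mul_deriv hgc.measurable hgi hs₀)] at h2
  filter_upwards [hgd (ε / 4) (by positivity), eventually_mem_nhdsWithin,
    eventually_nhdsWithin_of_eventually_nhds (h.isOpen.mem_nhds hs₀)] with s h1 hs hsI
  have hpos : 0 < |s - s₀| := abs_pos.2 (sub_ne_zero.2 hs)
  -- The Lipschitz bound for `ρ - g` compares the two difference quotients uniformly in `s`, so `g`
  -- can be fixed before `s` tends to `s₀`.
  have h3 := h.abs_increment_le (hρ.sub hgi) hs₀ hsI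
  simp only [Pi.sub_apply] at h3
  rw [hlin hgi s, hlin hgi s₀] at h3
  have h4 : |slope (fun s => ∫ u, (∫ t in (0 : ℝ)..φ s u, ρ t) ∂μ) s₀ s -
      slope (fun s => ∫ u, (∫ t in (0 : ℝ)..φ s u, g t) ∂μ) s₀ s| ≤ C * ∫ y, ‖ρ y - g y‖ := by
    rw [slope_def_field, slope_def_field, ← sub_div, abs_div, div_le_iff₀ hpos, mul_comm]
    refine le_trans (le_of_eq ?_) h3
    congr 1
    ring
  rw [Real.dist_eq] at h1 ⊢
  have b1 := abs_lt.1 h1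
  have b2 := abs_le.1 (h2.trans hCle)
  have b3 := abs_le.1 (h4.trans hCle)
  rw [abs_lt]
  constructor <;> linarith [b1.1, b1.2, b2.1, b2.2, b3.1, b3.2]

end DominatedFlow

/-! ### Monotone absolutely continuous functions on an interval -/

section MonotoneAbsolutelyContinuous

variable {r : ℝ → ℝ} {S : Set ℝ}

theorem measurable_indicator_deriv_of_ordConnected (r : ℝ → ℝ) (hS : S.OrdConnected) :
    Measurable (S.indicator (deriv r)) :=
  (measurable_deriv r).indicator hS.measurableSet

/-- A monotone, absolutely continuous function of bounded range has an integrable derivative. -/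
theorem MonotoneOn.lintegral_indicator_deriv_le (hS : S.OrdConnected) (hr : MonotoneOn r S)
    (hac : ∀ a ∈ S, ∀ b ∈ S, AbsolutelyContinuousOnInterval r a b) {D : ℝ}
    (hD : ∀ a ∈ S, ∀ b ∈ S, r b - r a ≤ D) :
    ∫⁻ y, ‖S.indicator (deriv r) y‖ₑ ≤ ENNReal.ofReal D := by
  -- In the interior `deriv` agrees with `derivWithin` on `S`, hence is nonnegative, and its
  -- integral is an increment of `r`.
  have hIcc : ∀ a b, a ≤ b → Set.Icc a b ⊆ interior S →
      ∫⁻ y in Set.Icc a b, ‖deriv r y‖ₑ ≤ ENNReal.ofReal D := by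
    intro a b hab hsub
    have ha : a ∈ S := interior_subset (hsub (Set.left_mem_Icc.2 hab))
    have hb : b ∈ S := interior_subset (hsub (Set.right_mem_Icc.2 hab))
    have hnn : ∀ y ∈ Set.Icc a b, 0 ≤ deriv r y := fun y hy => by
      rw [← derivWithin_of_mem_nhds (mem_interior_iff_mem_nhds.1 (hsub hy))]
      exact hr.derivWithin_nonneg
    have hint : IntegrableOn (deriv r) (Set.Icc a b) := by
      rw [integrableOn_Icc_iff_integrableOn_Ioc, ← intervalIntegrable_iff_integrableOn_Ioc_of_le hab]
      exact (hac a ha b hb).intervalIntegrable_deriv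
    have h1 : ∫⁻ y in Set.Icc a b, ‖deriv r y‖ₑ =
        ∫⁻ y in Set.Icc a b, ENNReal.ofReal (deriv r y) :=
      setLIntegral_congr_fun measurableSet_Icc fun y hy =>
        Real.enorm_of_nonneg (hnn y hy)
    rw [h1, ← ofReal_integral_eq_lintegral_ofReal hint
      ((ae_restrict_iff' measurableSet_Icc).2 (Eventually.of_forall hnn)),
      integral_Icc_eq_integral_Ioc, ← intervalIntegral.integral_of_le hab,
      (hac a ha b hb).integral_deriv_eq_sub]
    exact ENNReal.ofReal_le_ofReal (hD a ha b hb)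
  have hae : (interior S : Set ℝ) =ᵐ[volume] S := by
    refine (ae_le_set.2 ?_).antisymm (ae_le_set.2 ?_)
    · rw [Set.sdiff_eq_empty.2 interior_subset, measure_empty]
    · exact measure_mono_null (Set.sdiff_subset_sdiff_left subset_closure)
        (hS.convex.addHaar_frontier volume)
  simp only [enorm_indicator_eq_indicator_enorm]
  rw [lintegral_indicator hS.measurableSet, ← setLIntegral_congr hae]
  -- The interior is exhausted by compact sets. Each lies between its least and greatest elements,
  -- and that interval stays in the interior by order-connectedness.
  obtain ⟨Fs, hcl, hFs, hU, hmono⟩ := (isOpen_interior (s := S)).exists_iUnion_isClosed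
  have hU' : interior S = ⋃ n : ℕ, Fs n ∩ Set.Icc (-(n : ℝ)) n := by
    refine Set.Subset.antisymm (fun y hy => ?_)
      (Set.iUnion_subset fun n => Set.inter_subset_left.trans (hFs n))
    rw [← hU] at hy
    obtain ⟨n, hn⟩ := Set.mem_iUnion.1 hy
    obtain ⟨k, hk⟩ := exists_nat_ge |y|
    refine Set.mem_iUnion.2 ⟨max n k, hmono (le_max_left _ _) hn, abs_le.1 (hk.trans ?_)⟩
    exact_mod_cast le_max_right n k
  have hmono' : Monotone fun n : ℕ => Fs n ∩ Set.Icc (-(n : ℝ)) n := fun n k hnk =>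
    Set.inter_subset_inter (hmono hnk) (Set.Icc_subset_Icc (by simpa using hnk) (by simpa using hnk))
  rw [hU', setLIntegral_iUnion_of_directed _ hmono'.directed_le]
  refine iSup_le fun n => ?_
  have hK : IsCompact (Fs n ∩ Set.Icc (-(n : ℝ)) n) := isCompact_Icc.inter_left (hcl n)
  rcases (Fs n ∩ Set.Icc (-(n : ℝ)) n).eq_empty_or_nonempty with he | hne
  · simp [he]
  · obtain ⟨a, ha⟩ := hK.exists_isLeast hne
    obtain ⟨b, hb⟩ := hK.exists_isGreatest hne
    have hsub : Fs n ∩ Set.Icc (-(n : ℝ)) n ⊆ Set.Icc a b := fun y hy => ⟨ha.2 hy, hb.2 hy⟩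
    refine (lintegral_mono_set hsub).trans (hIcc a b (ha.2 hb.1) ?_)
    exact hS.interior.out (hFs n ha.1.1) (hFs n hb.1.1)

theorem MonotoneOn.integrable_indicator_deriv (hS : S.OrdConnected) (hr : MonotoneOn r S)
    (hac : ∀ a ∈ S, ∀ b ∈ S, AbsolutelyContinuousOnInterval r a b) {D : ℝ}
    (hD : ∀ a ∈ S, ∀ b ∈ S, r b - r a ≤ D) :
    Integrable (S.indicator (deriv r)) :=
  ⟨(measurable_indicator_deriv_of_ordConnected r hS).aestronglyMeasurable,
    (hr.lintegral_indicator_deriv_le hS hac hD).trans_lt ENNReal.ofReal_lt_top⟩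

theorem MonotoneOn.integral_norm_indicator_deriv_le (hS : S.OrdConnected) (hr : MonotoneOn r S)
    (hac : ∀ a ∈ S, ∀ b ∈ S, AbsolutelyContinuousOnInterval r a b) {D : ℝ} (hD0 : 0 ≤ D)
    (hD : ∀ a ∈ S, ∀ b ∈ S, r b - r a ≤ D) :
    ∫ y, ‖S.indicator (deriv r) y‖ ≤ D := by
  rw [integral_norm_eq_lintegral_enorm (hr.integrable_indicator_deriv hS hac hD).1]
  exact ENNReal.toReal_le_of_le_ofReal hD0 (hr.lintegral_indicator_deriv_le hS hac hD)

theorem AbsolutelyContinuousOnInterval.integral_indicator_deriv (hS : S.OrdConnected) {a b : ℝ}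
    (hac : AbsolutelyContinuousOnInterval r a b) (ha : a ∈ S) (hb : b ∈ S) :
    ∫ y in a..b, S.indicator (deriv r) y = r b - r a := by
  rw [← hac.integral_deriv_eq_sub]
  exact intervalIntegral.integral_congr fun y hy =>
    Set.indicator_of_mem (hS.uIcc_subset ha hb hy) _

end MonotoneAbsolutelyContinuous

/-! ### Disintegration and conditional independence -/

/-- The mean of `ρ (H) Z` in terms of the density of `H` and the conditional mean of `Z`. -/
theorem integral_mul_condDistrib {α : Type*} [MeasurableSpace α] {μ : Measure α}
    [IsProbabilityMeasure μ] {H Z : α → ℝ} (hH : Measurable H) (hZ : Measurable Z)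
    {ρ f e : ℝ → ℝ} (hρ : Measurable ρ) (hint : Integrable (fun u => ρ (H u) * Z u) μ)
    (hfm : Measurable f) (hf0 : ∀ y, 0 ≤ f y)
    (hf : μ.map H = volume.withDensity (fun y => ENNReal.ofReal (f y)))
    (he : ∀ᵐ y ∂μ.map H, e y = ∫ z, z ∂condDistrib Z H μ y) :
    Integrable (fun y => ρ y * f y * e y) ∧
      ∫ y, ρ y * f y * e y = ∫ u, ρ (H u) * Z u ∂μ := by
  have hm : Measurable fun p : ℝ × ℝ => ρ p.1 * p.2 :=
    (hρ.comp measurable_fst).mul measurable_snd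
  have hpair : AEMeasurable (fun u => (H u, Z u)) μ := (hH.prodMk hZ).aemeasurable
  have hint' : Integrable (fun p : ℝ × ℝ => ρ p.1 * p.2) (μ.map fun u => (H u, Z u)) :=
    (integrable_map_measure hm.aestronglyMeasurable hpair).2 hint
  have h1 := hint'.integral_condDistrib_map hZ.aemeasurable
  have h2 : ∫ u, ρ (H u) * Z u ∂μ = ∫ y, ∫ z, ρ y * z ∂condDistrib Z H μ y ∂μ.map H := by
    rw [← integral_map hpair hm.aestronglyMeasurable (f := fun p : ℝ × ℝ => ρ p.1 * p.2)]
    rw [← compProd_map_condDistrib hZ.aemeasurable] at hint' ⊢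
    rw [Measure.integral_compProd hint']
  have hcongr : (fun y => ∫ z, ρ y * z ∂condDistrib Z H μ y) =ᵐ[μ.map H] fun y => ρ y * e y := by
    filter_upwards [he] with y hy
    rw [hy]
    exact integral_const_mul (ρ y) fun z => z
  rw [h2, integral_congr_ae hcongr]
  have h3 := h1.congr hcongr
  have hfm' : Measurable fun y => ENNReal.ofReal (f y) := hfm.ennreal_ofReal
  have hlt : ∀ᵐ y, ENNReal.ofReal (f y) < ⊤ := Eventually.of_forall fun _ => ENNReal.ofReal_lt_top
  rw [hf] at h3 ⊢
  have heq : (fun y => ρ y * f y * e y) =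
      fun y => (ENNReal.ofReal (f y)).toReal • (ρ y * e y) := by
    ext y
    rw [ENNReal.toReal_ofReal (hf0 y), smul_eq_mul]
    ring
  rw [heq]
  exact ⟨(integrable_withDensity_iff_integrable_smul' hfm' hlt).1 h3,
    (integral_withDensity_eq_integral_toReal_smul hfm' hlt _).symm⟩

/-- Under conditional independence, the conditional distribution does not change when the
independent variable is added to the conditioning variables. -/
theorem ProbabilityTheory.HasCondDistrib.prodMkRight_of_condIndepFun {Ω β γ δ : Type*}
    [MeasurableSpace Ω] [StandardBorelSpace Ω] [MeasurableSpace β] [StandardBorelSpace β]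
    [Nonempty β] [MeasurableSpace γ] [MeasurableSpace δ] [StandardBorelSpace δ] [Nonempty δ]
    {P : Measure Ω} [IsProbabilityMeasure P] {Y : Ω → β} {K : Ω → γ} {T : Ω → δ}
    (hY : Measurable Y) (hK : Measurable K) (hT : Measurable T) {κ : Kernel γ β}
    [IsMarkovKernel κ] (h : HasCondDistrib Y K κ P)
    (hind : CondIndepFun (MeasurableSpace.comap K inferInstance) hK.comap_le T Y P) :
    HasCondDistrib Y (fun ω => (K ω, T ω)) (κ.prodMkRight δ) P := by
  refine ⟨((hK.prodMk hT).prodMk hY).aemeasurable, ?_⟩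
  rw [← condDistrib_ae_eq_iff_measure_eq_compProd _ hY.aemeasurable]
  have h1 := (condIndepFun_iff_condDistrib_prod_ae_eq_prodMkRight hY hT hK).1 hind
  have h2 : condDistrib Y K P =ᵐ[P.map K] κ :=
    condDistrib_ae_eq_of_measure_eq_compProd K hY.aemeasurable h.map_eq
  have h3 : ∀ᵐ p ∂P.map (fun ω => (K ω, T ω)), condDistrib Y K P p.1 = κ p.1 := by
    have h4 : P.map K = (P.map (fun ω => (K ω, T ω))).map Prod.fst := by
      rw [Measure.map_map measurable_fst (hK.prodMk hT)]
      rfl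
    rw [h4] at h2
    exact ae_of_ae_map measurable_fst.aemeasurable h2
  filter_upwards [h1, h3] with p hp hp3
  rw [hp, Kernel.prodMkRight_apply, Kernel.prodMkRight_apply, hp3]

/-- The joint conditional distribution of two variables. -/
theorem ProbabilityTheory.HasCondDistrib.compProd {Ω β γ δ : Type*}
    [MeasurableSpace Ω] [MeasurableSpace β] [MeasurableSpace γ] [MeasurableSpace δ]
    {P : Measure Ω} [IsProbabilityMeasure P] {X : Ω → β} {Y : Ω → γ} {Z : Ω → δ}
    {κ : Kernel β γ} [IsMarkovKernel κ] {η : Kernel (β × γ) δ} [IsMarkovKernel η]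
    (hY : HasCondDistrib Y X κ P) (hZ : HasCondDistrib Z (fun ω => (X ω, Y ω)) η P) :
    HasCondDistrib (fun ω => (Y ω, Z ω)) X (κ ⊗ₖ η) P := by
  have hX := hY.aemeasurable_fst
  have hYm := hY.aemeasurable_snd
  have hZm := hZ.aemeasurable_snd
  refine ⟨by fun_prop, ?_⟩
  have h1 : P.map (fun ω => (X ω, (Y ω, Z ω))) =
      (P.map (fun ω => ((X ω, Y ω), Z ω))).map MeasurableEquiv.prodAssoc := by
    rw [AEMeasurable.map_map_of_aemeasurable (by fun_prop) (by fun_prop)]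
    rfl
  rw [h1, hZ.map_eq, hY.map_eq, ← Measure.compProd_assoc,
    MeasurableEquiv.map_map_symm]

/-! ### Conditional laws and conditional mean given the regressors -/

namespace CondLaws

variable {J k : ℕ} {Ω 𝒰 𝒱 : Type*} [MeasurableSpace Ω] [MeasurableSpace 𝒰] [MeasurableSpace 𝒱]
  {m : ReportModel J k Ω 𝒰 𝒱}

theorem _root_.ReportModel.measurable_X (m : ReportModel J k Ω 𝒰 𝒱) : Measurable m.X :=
  m.measurable_T.prodMk m.measurable_W

theorem hasCondDistrib_V [StandardBorelSpace Ω] [StandardBorelSpace 𝒱] (F : CondLaws m)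
    (exog : m.Exog) : HasCondDistrib m.V m.X F.FVgivenX m.P := by
  have : Nonempty Ω := nonempty_of_isProbabilityMeasure m.P
  have : Nonempty 𝒱 := this.map m.V
  exact (F.hasCondDistrib_FV.prodMkRight_of_condIndepFun m.measurable_V m.measurable_W
    m.measurable_T exog.1).comp_right (f := Prod.swap) (κ := F.FVgivenX)
    (hf := measurable_swap)

theorem hasCondDistrib_U [StandardBorelSpace Ω] [StandardBorelSpace 𝒰] (F : CondLaws m)
    (exog : m.Exog) :
    HasCondDistrib m.U (fun ω => (m.X ω, m.V ω)) F.FUgivenXV m.P := by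
  have : Nonempty Ω := nonempty_of_isProbabilityMeasure m.P
  have : Nonempty 𝒰 := this.map m.U
  exact (F.hasCondDistrib_FU.prodMkRight_of_condIndepFun m.measurable_U
    (m.measurable_W.prodMk m.measurable_V) m.measurable_T exog.2).comp_right
    (f := fun p : ((Fin k → ℝ) × 𝒱) × (Fin J → ℝ) => ((p.2, p.1.1), p.1.2)) (κ := F.FUgivenXV) (hf := by fun_prop)

/-- The two conditional laws compose to the law of `(V, U)` given `X`; the iterated integral in
`meanR` is Fubini for this composition. -/
theorem condExp_R_ae_eq [StandardBorelSpace Ω] [StandardBorelSpace 𝒰] [StandardBorelSpace 𝒱]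
    (F : CondLaws m) (exog : m.Exog) :
    m.P[m.R | MeasurableSpace.comap m.X inferInstance] =ᵐ[m.P] fun ω => F.meanR (m.X ω) := by
  have : Nonempty Ω := nonempty_of_isProbabilityMeasure m.P
  have : Nonempty 𝒰 := this.map m.U
  have : Nonempty 𝒱 := ‹Nonempty Ω›.map m.V
  obtain ⟨C, hC⟩ := m.bounded_𝓡.exists_norm_le
  have hVU := (F.hasCondDistrib_V exog).compProd (F.hasCondDistrib_U exog)
  have hmVU : Measurable fun ω => (m.V ω, m.U ω) := m.measurable_V.prodMk m.measurable_U
  have hm : Measurable fun p : Regressors J k × 𝒱 × 𝒰 => m.r (m.h p.1 p.2.2) p.2.1 :=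
    m.measurable_r.comp ((m.measurable_h.comp
      (measurable_fst.prodMk measurable_snd.snd)).prodMk measurable_snd.fst)
  have hbound : ∀ x ∈ m.𝒳, ∀ q : 𝒱 × 𝒰, ‖m.r (m.h x q.2) q.1‖ ≤ C := fun x hx q =>
    hC _ (m.r_mem _ (m.h_mem x hx _) _)
  have hint : Integrable (fun ω => m.r (m.h (m.X ω) (m.U ω)) (m.V ω)) m.P :=
    Integrable.of_bound (hm.comp (m.measurable_X.prodMk hmVU)).aestronglyMeasurable C
      (m.X_mem.mono fun ω hω => hbound _ hω (m.V ω, m.U ω))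
  have h1 := condExp_prod_ae_eq_integral_condDistrib m.measurable_X hmVU.aemeasurable
    hm.stronglyMeasurable hint
  have h2 := ae_of_ae_map m.measurable_X.aemeasurable
    (condDistrib_ae_eq_of_measure_eq_compProd m.X hmVU.aemeasurable hVU.map_eq)
  refine EventuallyEq.trans h1 ?_
  filter_upwards [h2, m.X_mem] with ω hω hX
  rw [hω]
  refine integral_compProd ?_
  exact Integrable.of_bound (hm.comp (measurable_const.prodMk measurable_id)).aestronglyMeasurable
    C (Eventually.of_forall fun q => hbound _ hX q)

end CondLaws

/-! ### Differentiating the conditional mean in one component -/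

section MoveTo

variable {J k : ℕ} (j : Fin J) (x : Regressors J k)

@[simp]
theorem moveTo_fst_apply (s : ℝ) : (moveTo j x s).1 j = s := Function.update_self _ _ _

@[simp]
theorem moveTo_moveTo (s t : ℝ) : moveTo j (moveTo j x s) t = moveTo j x t := by
  simp [moveTo]

@[simp]
theorem moveTo_self : moveTo j x (x.1 j) = x := by
  simp [moveTo]

theorem measurable_moveTo : Measurable (moveTo j x) :=
  (measurable_update x.1).prodMk measurable_const

end MoveTo

namespace CondLaws

variable {J k : ℕ} {Ω 𝒰 𝒱 : Type*} [MeasurableSpace Ω] [MeasurableSpace 𝒰] [MeasurableSpace 𝒱]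
  {m : ReportModel J k Ω 𝒰 𝒱}

theorem _root_.ReportModel.exists_ball_moveTo_mem (m : ReportModel J k Ω 𝒰 𝒱) {j : Fin J}
    {x : Regressors J k} (hx : x ∈ m.interiorAlong j) :
    ∃ δ > 0, ∀ s ∈ Metric.ball (x.1 j) δ,
      moveTo j x s ∈ m.𝒳 ∧ moveTo j x s ∈ m.interiorAlong j := by
  obtain ⟨δ, hδ, h⟩ := Metric.eventually_nhds_iff_ball.1 (hx.and hx.eventually_nhds)
  refine ⟨δ, hδ, fun s hs => ⟨(h s hs).1, ?_⟩⟩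
  simpa [ReportModel.interiorAlong] using (h s hs).2

/-- The latent outcomes form a dominated flow in component `j`. -/
theorem dominatedFlow {j : Fin J} {F : CondLaws m} {x : Regressors J k} {δ : ℝ}
    (hdiff : ∀ x ∈ m.interiorAlong j, ∀ u,
      DifferentiableAt ℝ (fun s => m.h (moveTo j x s) u) (x.1 j))
    {ν : Measure ℝ} {c : ℝ → ENNReal} [SigmaFinite ν] (hc : Measurable c)
    (hcfin : ∫⁻ y', c y' * ‖y'‖ₑ ∂ν < ⊤)
    (hdens : ∀ x ∈ m.interiorAlong j, ∀ v, ∃ g : ℝ × ℝ → ENNReal, Measurable g ∧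
      (∀ p, g p ≤ c p.2) ∧
      (F.FUgivenXV (x, v)).map (fun u => (m.h x u, m.dh j x u))
        = (volume.prod ν).withDensity g)
    (hδ : ∀ s ∈ Metric.ball (x.1 j) δ, moveTo j x s ∈ m.interiorAlong j) (v : 𝒱) :
    DominatedFlow (F.FUgivenXV (x, v)) (fun s u => m.h (moveTo j x s) u)
      (fun s u => m.dh j (moveTo j x s) u) (ν.withDensity c) (Metric.ball (x.1 j) δ) where
  isOpen := Metric.isOpen_ball
  ordConnected := (convex_ball _ _).ordConnected
  measurable := m.measurable_h.comp
    (((measurable_moveTo j x).comp measurable_fst).prodMk measurable_snd)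
  hasDerivAt s hs u := by
    have h1 := (hdiff _ (hδ s hs) u).hasDerivAt
    simp only [moveTo_moveTo, moveTo_fst_apply] at h1
    simpa [ReportModel.dh] using h1
  map_le s hs := by
    obtain ⟨g, -, hgc, hmap⟩ := hdens _ (hδ s hs) v
    rw [prod_withDensity_right hc]
    -- Exogeneity enters here: `FUgivenXV` sees only the controls, so `hmap`, stated at `moveTo j x
    -- s`, concerns the very measure used at `x`.
    refine (le_of_eq hmap).trans (withDensity_mono (Eventually.of_forall hgc))
  lintegral_ne_top := by
    rw [lintegral_withDensity_eq_lintegral_mul _ hc measurable_enorm]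
    exact hcfin.ne

/-- Derivative and Lipschitz bound of the mean report given `X = x`, `V = v`. -/
theorem hasDerivAt_mean_given_V {j : Fin J} {F : CondLaws m} {x : Regressors J k} {v : 𝒱}
    (honest : m.Honest) (hcont : m.ContinuousReporting) {κ : Measure ℝ} [SFinite κ] {δ : ℝ}
    (hδ0 : 0 < δ) (hδ : ∀ s ∈ Metric.ball (x.1 j) δ, moveTo j x s ∈ m.𝒳)
    (hflow : DominatedFlow (F.FUgivenXV (x, v)) (fun s u => m.h (moveTo j x s) u)
      (fun s u => m.dh j (moveTo j x s) u) κ (Metric.ball (x.1 j) δ))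
    {D : ℝ} (hD0 : 0 ≤ D) (hD : ∀ p ∈ m.𝓡, ∀ q ∈ m.𝓡, q - p ≤ D)
    {f e : ℝ → ℝ} (hf : F.IsDensityH x v f) (he : F.IsMeanEffect j x v e) :
    IntegrableOn (fun y => m.slope y v * f y * e y) m.𝓗 ∧
      HasDerivAt (fun s => ∫ u, m.r (m.h (moveTo j x s) u) v ∂F.FUgivenXV (x, v))
        (∫ y in m.𝓗, m.slope y v * f y * e y) (x.1 j) ∧
      ∀ a ∈ Metric.ball (x.1 j) δ, ∀ b ∈ Metric.ball (x.1 j) δ,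
        |∫ u, m.r (m.h (moveTo j x b) u) v ∂F.FUgivenXV (x, v) -
          ∫ u, m.r (m.h (moveTo j x a) u) v ∂F.FUgivenXV (x, v)| ≤
        |b - a| * ((∫⁻ y, ‖y‖ₑ ∂κ).toReal * D) := by
  set μ := F.FUgivenXV (x, v) with hμ
  have hs₀ : x.1 j ∈ Metric.ball (x.1 j) δ := Metric.mem_ball_self hδ0
  have hmono := (honest v).1
  have hac := hcont v
  have hdiam : ∀ a ∈ m.𝓗, ∀ b ∈ m.𝓗, m.r b v - m.r a v ≤ D := fun a ha b hb =>
    hD _ (m.r_mem a ha v) _ (m.r_mem b hb v)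
  set ρ : ℝ → ℝ := m.𝓗.indicator (deriv fun z => m.r z v) with hρdef
  have hρm : Measurable ρ := measurable_indicator_deriv_of_ordConnected _ m.ordConnected_𝓗
  have hρ : Integrable ρ := hmono.integrable_indicator_deriv m.ordConnected_𝓗 hac hdiam
  have hρD : ∫ y, ‖ρ y‖ ≤ D :=
    hmono.integral_norm_indicator_deriv_le m.ordConnected_𝓗 hac hD0 hdiam
  have hx : x ∈ m.𝒳 := by simpa using hδ _ hs₀
  obtain ⟨u₀⟩ : Nonempty 𝒰 := nonempty_of_isProbabilityMeasure μ
  set y₀ := m.h x u₀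
  have hy₀ : y₀ ∈ m.𝓗 := m.h_mem x hx u₀
  -- Since `ρ` is extended by zero, its primitive can start at `0` even if `0 ∉ 𝓗`; the constant,
  -- read off at `y₀ ∈ 𝓗`, corrects the base point.
  have hprim : ∀ y ∈ m.𝓗, m.r y v =
      (m.r y₀ v - ∫ t in (0 : ℝ)..y₀, ρ t) + ∫ t in (0 : ℝ)..y, ρ t := by
    intro y hy
    have h1 := (hac y₀ hy₀ y hy).integral_indicator_deriv m.ordConnected_𝓗 hy₀ hy
    have h2 := intervalIntegral.integral_interval_sub_left
      (hρ.intervalIntegrable (a := 0) (b := y)) (hρ.intervalIntegrable (a := 0) (b := y₀))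
    rw [← hρdef] at h1
    linarith
  have hmean : ∀ s ∈ Metric.ball (x.1 j) δ, ∫ u, m.r (m.h (moveTo j x s) u) v ∂μ =
      (m.r y₀ v - ∫ t in (0 : ℝ)..y₀, ρ t) +
        ∫ u, (∫ t in (0 : ℝ)..m.h (moveTo j x s) u, ρ t) ∂μ := by
    intro s hs
    rw [integral_congr_ae (Eventually.of_forall fun u =>
      hprim _ (m.h_mem _ (hδ s hs) u)),
      integral_add (integrable_const _) (hflow.integrable_primitive hρ s)]
    simp
  have hder := hflow.hasDerivAt_integral_primitive hρm hρ hs₀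
  have hint := hflow.integrable_mul_deriv hρm hρ hs₀
  have hdhm := hflow.measurable_deriv hs₀
  simp only [moveTo_self] at hder hint hdhm
  have hcond := integral_mul_condDistrib (μ := μ)
    (m.measurable_h.comp (measurable_const.prodMk measurable_id)) hdhm hρm hint hf.1 hf.2.1
    hf.2.2 he.2
  have hind : (fun y => ρ y * f y * e y) =
      m.𝓗.indicator fun y => m.slope y v * f y * e y := by
    ext y
    by_cases hy : y ∈ m.𝓗 <;> simp [hρdef, hy, ReportModel.slope]
  rw [hind, integrable_indicator_iff m.ordConnected_𝓗.measurableSet,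
    integral_indicator m.ordConnected_𝓗.measurableSet] at hcond
  refine ⟨hcond.1, ?_, fun a ha b hb => ?_⟩
  · rw [hcond.2]
    refine (hder.const_add (m.r y₀ v - ∫ t in (0 : ℝ)..y₀, ρ t)).congr_of_eventuallyEq ?_
    filter_upwards [Metric.ball_mem_nhds (x.1 j) hδ0] with s hs using hmean s hs
  · rw [hmean a ha, hmean b hb, add_sub_add_left_eq_sub]
    refine (hflow.abs_increment_le hρ ha hb).trans ?_
    gcongr

/-- The bound `c` does not depend on `v`, so the means given `V = v` share one Lipschitz constant,
which serves as the dominating function. -/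
theorem hasDerivAt_meanR {j : Fin J} {F : CondLaws m} {x : Regressors J k}
    (honest : m.Honest) (hcont : m.ContinuousReporting) (hreg : F.Reg j)
    (hx : x ∈ m.interiorAlong j) {f e : 𝒱 → ℝ → ℝ}
    (hf : ∀ v, F.IsDensityH x v (f v)) (he : ∀ v, F.IsMeanEffect j x v (e v)) :
    (∀ v, IntegrableOn (fun y => m.slope y v * f v y * e v y) m.𝓗) ∧
      Integrable (fun v => ∫ y in m.𝓗, m.slope y v * f v y * e v y) (F.FV x.2) ∧
      HasDerivAt (fun s => F.meanR (moveTo j x s))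
        (∫ v, (∫ y in m.𝓗, m.slope y v * f v y * e v y) ∂F.FV x.2) (x.1 j) := by
  obtain ⟨δ, hδ0, hδ⟩ := m.exists_ball_moveTo_mem hx
  obtain ⟨ν, c, hν, hc, hcfin, hdens⟩ := hreg.density
  obtain ⟨A, hA0, hA⟩ := m.bounded_𝓡.exists_pos_norm_le
  have hD : ∀ p ∈ m.𝓡, ∀ q ∈ m.𝓡, q - p ≤ 2 * A := fun p hp q hq => by
    have h1 := abs_le.1 (hA p hp)
    have h2 := abs_le.1 (hA q hq)
    linarith [h1.1, h2.2]
  have key := fun v => hasDerivAt_mean_given_V honest hcont hδ0 (fun s hs => (hδ s hs).1)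
    (dominatedFlow hreg.differentiable_h hc hcfin hdens (fun s hs => (hδ s hs).2) v)
    (by positivity) hD (hf v) (he v)
  have hs₀ : x.1 j ∈ Metric.ball (x.1 j) δ := Metric.mem_ball_self hδ0
  set N : ℝ → 𝒱 → ℝ := fun s v => ∫ u, m.r (m.h (moveTo j x s) u) v ∂F.FUgivenXV (x, v) with hN
  have hNm : ∀ s, StronglyMeasurable (N s) := fun s => by
    have h1 : Measurable fun p : 𝒱 × 𝒰 => m.r (m.h (moveTo j x s) p.2) p.1 :=
      m.measurable_r.comp ((m.measurable_h.comp
        (measurable_const.prodMk measurable_snd)).prodMk measurable_fst)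
    exact h1.stronglyMeasurable.integral_kernel_prod_right'
      (κ := F.FUgivenXV.comap (fun v => (x, v)) measurable_prodMk_left)
  have hNbound : ∀ v, ‖N (x.1 j) v‖ ≤ A := fun v => by
    have h1 := norm_integral_le_of_norm_le_const (μ := F.FUgivenXV (x, v)) (C := A)
      (Eventually.of_forall fun u => hA _ (m.r_mem _ (m.h_mem _ (hδ _ hs₀).1 u) v))
    rwa [probReal_univ, mul_one] at h1
  -- The versions `f v` and `e v` need not be jointly measurable in `v`; measurability comes from
  -- the difference quotients of `N`.
  have hderm : AEStronglyMeasurable (fun v => ∫ y in m.𝓗, m.slope y v * f v y * e v y)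
      (F.FV x.2) := by
    refine aestronglyMeasurable_of_tendsto_ae atTop
      (f := fun (n : ℕ) v => (1 / ((n : ℝ) + 1))⁻¹ • (N (x.1 j + 1 / ((n : ℝ) + 1)) v - N (x.1 j) v))
      (fun n => (((hNm _).sub (hNm _)).const_smul (1 / ((n : ℝ) + 1))⁻¹).aestronglyMeasurable)
      (Eventually.of_forall fun v => ?_)
    exact (hasDerivAt_iff_tendsto_slope_zero.1 (key v).2.1).comp
      (tendsto_nhdsWithin_iff.2 ⟨tendsto_one_div_add_atTop_nhds_zero_nat,
        Eventually.of_forall fun n => (Nat.one_div_pos_of_nat (α := ℝ)).ne'⟩)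
  have hmain := hasDerivAt_integral_of_dominated_loc_of_lip (μ := F.FV x.2) (𝕜 := ℝ)
    (F := N) (bound := fun _ => (∫⁻ y, ‖y‖ₑ ∂ν.withDensity c).toReal * (2 * A))
    (Metric.ball_mem_nhds (x.1 j) hδ0)
    (Eventually.of_forall fun s => (hNm s).aestronglyMeasurable)
    (Integrable.of_bound (hNm _).aestronglyMeasurable A (Eventually.of_forall hNbound))
    hderm
    (Eventually.of_forall fun v => LipschitzOnWith.of_dist_le_mul fun b hb a ha => by
      rw [Real.dist_eq, Real.dist_eq, mul_comm, Real.coe_nnabs, abs_of_nonneg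
        (mul_nonneg ENNReal.toReal_nonneg (by positivity) :
          0 ≤ (∫⁻ y, ‖y‖ₑ ∂ν.withDensity c).toReal * (2 * A))]
      exact (key v).2.2 a ha b hb)
    (integrable_const _) (Eventually.of_forall fun v => (key v).2.1)
  exact ⟨fun v => (key v).1, hmain⟩

end CondLaws

theorem proposition3 {J k : ℕ} {Ω 𝒰 𝒱 : Type*}
    [MeasurableSpace Ω] [StandardBorelSpace Ω]
    [MeasurableSpace 𝒰] [StandardBorelSpace 𝒰]
    [MeasurableSpace 𝒱] [StandardBorelSpace 𝒱]
    (m : ReportModel J k Ω 𝒰 𝒱) (F : CondLaws m)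
    (honest : m.Honest) (continuousReporting : m.ContinuousReporting) (exog : m.Exog)
    (f : Regressors J k → 𝒱 → ℝ → ℝ)
    (hf : ∀ x ∈ m.𝒳, ∀ v, F.IsDensityH x v (f x v))
    (e : Fin J → Regressors J k → 𝒱 → ℝ → ℝ)
    (he : ∀ j, F.Reg j → ∀ x ∈ m.interiorAlong j, ∀ v, F.IsMeanEffect j x v (e j x v)) :
    -- the conditional distributions and means given `X` are what they are called
    (HasCondDistrib m.V m.X F.FVgivenX m.P ∧
      HasCondDistrib m.U (fun ω => (m.X ω, m.V ω)) F.FUgivenXV m.P ∧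
      m.P[m.R | MeasurableSpace.comap m.X inferInstance] =ᵐ[m.P] fun ω => F.meanR (m.X ω)) ∧
    -- the gradient of the conditional mean, component by component
    ∀ j, F.Reg j → ∀ x ∈ m.interiorAlong j,
      (∀ v, Tendsto (fun y => f x v y * e j x v y) atTop (𝓝 0) ∧
        Tendsto (fun y => f x v y * e j x v y) atBot (𝓝 0)) →
      (∀ v, IntegrableOn (fun y => m.slope y v * f x v y * e j x v y) m.𝓗) ∧
      Integrable (fun v => ∫ y in m.𝓗, m.slope y v * f x v y * e j x v y)
        (F.FV x.2) ∧
      HasDerivAt (fun s => F.meanR (moveTo j x s))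
        (∫ v, (∫ y in m.𝓗, m.slope y v * f x v y * e j x v y) ∂F.FV x.2)
        (x.1 j) := by
  refine ⟨⟨F.hasCondDistrib_V exog, F.hasCondDistrib_U exog, F.condExp_R_ae_eq exog⟩,
    fun j hreg x hx _ => ?_⟩
  have hx' : x ∈ m.𝒳 := by
    have := Eventually.self_of_nhds hx
    rwa [moveTo_self] at this
  exact CondLaws.hasDerivAt_meanR honest continuousReporting hreg hx (hf x hx')
    (he j hreg x hx)
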